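/- Let $\Gamma:=\{(2k-1)2^{2\ell-1} : k,\ell\in\{1,2,3,\dots\}\}$. For $t\in(0,1)$ let $\Omega_t:=\{0,\,3t,\,3,\,3t+3\}$ and $f_d(x):=\frac{x+d}{4}$ for $d\in\Omega_t$, $x\in\mathbb R$. The iterated function system $\Phi_t:=\{f_d : d\in\Omega_t\}$ generates the projection $C_t=\{x+ty : (x,y)\in C\}$ of the four corner Cantor set $C$, the self-similar set in $\mathbb R^2$ generated by the four maps $(x,y)\mapsto\frac{(x,y)+(a,b)}{4}$ with $a,b\in\{0,3\}$. One says that $C_t$ has an exact overlap if the system $\Phi_t$ does, that is, if there are $k\ge 1$ and two different blocks $i_1\ldots i_k\ne j_1\ldots j_k$ in $\Omega_t^k$ such that $f_{i_1}\circ\cdots\circ f_{i_k}=f_{j_1}\circ\cdots\circ f_{j_k}$. Theorem. Let $t\in(0,1)$. Then $C_t$ has an exact overlap if and only if there are coprime positive integers $p,q$ with $t=p/q$, $p\notin\Gamma$ and $q\notin\Gamma$. -/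

import Mathlib

namespace FourCorner

/-- The digit set `{0, 3t, 3, 3t+3}` of the IFS that generates the projection
`C_t = {x + t y : (x, y) ∈ C}` of the four corner Cantor set `C`. -/
def digits (t : ℝ) : Set ℝ := {0, 3 * t, 3, 3 * t + 3}

/-- The contraction `f_d(x) = (x + d) / 4`. The IFS `Φ_t` consists of the maps `contr d` with
`d ∈ digits t`. -/
noncomputable def contr (d : ℝ) (x : ℝ) : ℝ := (x + d) / 4

/-- The composition `f_{i₁} ∘ ⋯ ∘ f_{iₖ}` along a block `i₁ … iₖ` of `k` digits. -/
noncomputable def blockMap {D : Set ℝ} : {k : ℕ} → (Fin k → D) → ℝ → ℝ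
  | 0, _ => id
  | _ + 1, i => contr (i 0 : ℝ) ∘ blockMap (fun n => i n.succ)

/-- The IFS `Φ_t` (equivalently, by convention, its self-similar set `C_t`) has an exact overlap:
two different blocks of digits of the same length give the same map. -/
def HasExactOverlap (t : ℝ) : Prop :=
  ∃ (k : ℕ) (i j : Fin k → digits t), i ≠ j ∧ blockMap i = blockMap j

/-- The set `Γ = {(2k-1) 2^(2ℓ-1) : k, ℓ = 1, 2, 3, …}`. -/
def Gam : Set ℕ := {n | ∃ k l : ℕ, 1 ≤ k ∧ 1 ≤ l ∧ n = (2 * k - 1) * 2 ^ (2 * l - 1)}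

end FourCorner

/-!
Each digit of `Φ_t` is `3 (x + t y)` with `x, y ∈ {0, 1}`, so an exact overlap is a coincidence
`∑ₙ 4ⁿ (xₙ + t yₙ) = ∑ₙ 4ⁿ (x'ₙ + t y'ₙ)` between two different binary words
(`hasExactOverlap_iff`), and `Γ` is the set of positive integers with odd 2-adic valuation
(`mem_Gam_iff`).

Given an overlap, `X + t Y = 0` for integers `X`, `Y` with base `4` digits in `{-1, 0, 1}`. Such
integers have even 2-adic valuation and vanish only if all their digits do
(`even_padicValInt_sum_four_pow`). Hence `t = |X| / |Y|`, and cancelling common factors leaves a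
numerator and a denominator of even 2-adic valuation.

Conversely, let `p = 4ᵃ p'` and `q = 4ᵇ q'` with `p'`, `q'` odd, and suppose that for every `k` the
`4ᵏ` integers `∑_{n<k} 4ⁿ (xₙ p + yₙ q)` are distinct. They lie below `M = 4^(k+L)` with `L`
independent of `k`, so Parseval's identity modulo `M` (`sum_norm_sq_sum_stdAddChar`) says that their
exponential sum `F` satisfies `∑ᵣ |F(r)|² = M 4ᵏ = 4ᴸ 16ᵏ`. Now `F` factors as
`∏_{n<k} (1 + e(4ⁿ p r / M)) (1 + e(4ⁿ q r / M))`, and at each of the `k` frequencies `r = M / 4ʲ`,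
`1 ≤ j ≤ k`, it has absolute value at least `c 4ᵏ`, where `c > 0` depends only on `p'` and `q'`
(`le_prod_of_four_pow_mul_odd`): no factor vanishes since `p'` and `q'` are odd, and the telescoping
product `∏ (1 + w^(2ⁿ))`, half of whose factors are discarded, makes the bound uniform. So
`k c² ≤ 4ᴸ` for all `k`, which is absurd. This is a finite form of the Riemann–Lebesgue argument by
which the self-similar measure of the system cannot be absolutely continuous.
-/

namespace FourCorner

open Finset

/-! ### Lower bound for the trigonometric product -/

/-- The product `(w - 1) ∏_{n ≤ 2j} (1 + w^(2ⁿ))` telescopes; its `j` factors with odd `n` are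
estimated by `2`. -/
lemma norm_pow_sub_one_le_prod (w : ℂ) (hw : ‖w‖ = 1) (j : ℕ) :
    ‖w ^ 2 ^ (2 * j + 1) - 1‖ ≤
      (∏ n ∈ range (j + 1), ‖1 + w ^ 4 ^ n‖) * 2 ^ j * ‖w - 1‖ := by
  induction j with
  | zero =>
    have : w ^ 2 ^ (2 * 0 + 1) - 1 = (1 + w) * (w - 1) := by ring
    rw [this, norm_mul]
    simp
  | succ j ih =>
    set v := w ^ 2 ^ (2 * j + 1) with hv
    have h1 : w ^ 2 ^ (2 * (j + 1) + 1) - 1 = (v - 1) * (v + 1) * (1 + w ^ 4 ^ (j + 1)) := by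
      have h4 : w ^ 4 ^ (j + 1) = v ^ 2 := by
        rw [hv, ← pow_mul]; congr 1
        rw [show (4 : ℕ) = 2 ^ 2 by norm_num, ← pow_mul]; ring
      have h8 : w ^ 2 ^ (2 * (j + 1) + 1) = v ^ 4 := by
        rw [hv, ← pow_mul]; congr 1; ring
      rw [h4, h8]; ring
    have h2 : ‖v + 1‖ ≤ 2 := by
      refine (norm_add_le _ _).trans ?_
      simp only [hv, norm_pow, hw, one_pow, norm_one]; norm_num
    rw [h1, norm_mul, norm_mul, prod_range_succ]
    calc ‖v - 1‖ * ‖v + 1‖ * ‖1 + w ^ 4 ^ (j + 1)‖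
        ≤ ((∏ n ∈ range (j + 1), ‖1 + w ^ 4 ^ n‖) * 2 ^ j * ‖w - 1‖) * 2
            * ‖1 + w ^ 4 ^ (j + 1)‖ := by gcongr
      _ = _ := by ring

lemma prod_range_le_prod_range_of_le_one {a : ℕ → ℝ} (h0 : ∀ n, 0 ≤ a n) (h1 : ∀ n, a n ≤ 1)
    {i : ℕ} (hi : ∀ n, i ≤ n → a n = 1) (k : ℕ) :
    ∏ n ∈ range i, a n ≤ ∏ n ∈ range k, a n := by
  rcases le_total k i with h | h
  · obtain ⟨d, rfl⟩ := Nat.exists_eq_add_of_le h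
    rw [prod_range_add]
    exact mul_le_of_le_one_right (prod_nonneg fun n _ => h0 n)
      (prod_le_one (fun n _ => h0 _) fun n _ => h1 _)
  · obtain ⟨d, rfl⟩ := Nat.exists_eq_add_of_le h
    rw [prod_range_add, prod_eq_one (s := range d) fun n _ => hi _ (Nat.le_add_right _ _), mul_one]

lemma two_div_pi_mul_le_one {m : ℕ} (hm : m ≠ 0) : 2 / (Real.pi * m) ≤ 1 := by
  have h1 : (1 : ℝ) ≤ m := by exact_mod_cast Nat.one_le_iff_ne_zero.mpr hm
  rw [div_le_one (by positivity)]
  nlinarith [Real.pi_gt_three]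

/-- Uniform lower bound for the partial products of `∏ₙ |cos (π 4ⁿ m / 4ⁱ)|` with `m` odd. -/
lemma le_prod_of_odd {m : ℕ} (hm : Odd m) (i k : ℕ) {w : ℂ}
    (hw : w = Complex.exp (Complex.I * ((2 * Real.pi * m / 4 ^ i : ℝ) : ℂ))) :
    2 / (Real.pi * m) ≤ ∏ n ∈ range k, ‖1 + w ^ 4 ^ n‖ / 2 := by
  have hm0 : m ≠ 0 := by rintro rfl; simp at hm
  have hmpos : (0 : ℝ) < m := by positivity
  have hw1 : ‖w‖ = 1 := by rw [hw, mul_comm]; exact Complex.norm_exp_ofReal_mul_I _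
  have hwi : w ^ 4 ^ i = 1 := by
    rw [hw, ← Complex.exp_nat_mul, Complex.exp_eq_one_iff]
    refine ⟨m, ?_⟩
    push_cast
    field_simp
  refine le_trans ?_ (prod_range_le_prod_range_of_le_one (i := i) (fun n => by positivity)
    (fun n => ?_) (fun n hn => ?_) k)
  · rcases i with _ | j
    · simpa using two_div_pi_mul_le_one hm0
    -- as `m` is odd, `w ^ 2 ^ (2 * j + 1) = exp (π i m) = -1`
    have hneg : w ^ 2 ^ (2 * j + 1) = -1 := by
      obtain ⟨l, hl⟩ := hm
      rw [hw, ← Complex.exp_nat_mul]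
      have : ((2 ^ (2 * j + 1) : ℕ) : ℂ) * (Complex.I * ((2 * Real.pi * m / 4 ^ (j + 1) : ℝ) : ℂ))
          = Real.pi * Complex.I + l * (2 * Real.pi * Complex.I) := by
        have h4 : (4 : ℂ) ^ (j + 1) = 2 * 2 ^ (2 * j + 1) := by
          rw [show (4 : ℂ) = 2 ^ 2 by norm_num, ← pow_mul]; ring
        rw [hl]; push_cast; rw [h4]
        field_simp; ring
      rw [this, Complex.exp_add, Complex.exp_pi_mul_I, Complex.exp_nat_mul_two_pi_mul_I, mul_one]
    have hle := norm_pow_sub_one_le_prod w hw1 j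
    rw [hneg, show ‖(-1 - 1 : ℂ)‖ = 2 by norm_num] at hle
    have hd : ‖w - 1‖ ≤ 2 * Real.pi * m / 4 ^ (j + 1) := by
      rw [hw]
      refine Real.norm_exp_I_mul_ofReal_sub_one_le.trans ?_
      rw [Real.norm_of_nonneg (by positivity)]
    rw [prod_div_distrib, prod_const, card_range]
    set P := ∏ n ∈ range (j + 1), ‖1 + w ^ 4 ^ n‖ with hP
    have hP0 : 0 ≤ P := prod_nonneg fun n _ => norm_nonneg _
    have h2 : 2 ≤ P * 2 ^ j * (2 * Real.pi * m / 4 ^ (j + 1)) :=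
      hle.trans (by gcongr)
    have h4 : (4 : ℝ) ^ (j + 1) = 4 * (2 ^ j * 2 ^ j) := by
      rw [← mul_pow, pow_succ]; norm_num; ring
    have h3 : P * 2 ^ j * (2 * Real.pi * m / 4 ^ (j + 1)) = P / 2 ^ (j + 1) * (Real.pi * m) := by
      rw [h4, pow_succ]; field_simp; norm_num
    rw [div_le_iff₀ (by positivity), ← h3]
    exact h2
  · rw [div_le_one two_pos]
    refine (norm_add_le _ _).trans ?_
    simp only [norm_pow, hw1, one_pow, norm_one]; norm_num
  · obtain ⟨d, rfl⟩ := Nat.exists_eq_add_of_le hn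
    rw [pow_add, pow_mul, hwi, one_pow]; norm_num

/-- The bound of `le_prod_of_odd` survives a factor `4 ^ a`, which only shifts the product and
adds factors equal to `1`. -/
lemma le_prod_of_four_pow_mul_odd {m : ℕ} (hm : Odd m) (a j k : ℕ) {w : ℂ}
    (hw : w = Complex.exp (Complex.I * ((2 * Real.pi * (4 ^ a * m : ℕ) / 4 ^ j : ℝ) : ℂ))) :
    2 / (Real.pi * m) ≤ ∏ n ∈ range k, ‖1 + w ^ 4 ^ n‖ / 2 := by
  rcases le_total j a with h | h
  · obtain ⟨d, rfl⟩ := Nat.exists_eq_add_of_le h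
    have hw1 : w = 1 := by
      rw [hw, Complex.exp_eq_one_iff]
      refine ⟨(4 ^ d * m : ℕ), ?_⟩
      push_cast
      rw [pow_add]
      field_simp
    subst hw1
    rw [prod_eq_one fun n _ => by norm_num]
    exact two_div_pi_mul_le_one (by rintro rfl; simp at hm)
  · obtain ⟨d, rfl⟩ := Nat.exists_eq_add_of_le h
    refine le_prod_of_odd hm d k (hw.trans ?_)
    congr 3
    push_cast
    rw [pow_add]
    field_simp

/-! ### A coincidence among the integer sums -/

/-- The integer `∑ₙ 4ⁿ (xₙ p + yₙ q)` for a word of pairs `(xₙ, yₙ)` of binary digits. -/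
def wordSum (p q : ℕ) {k : ℕ} (u : Fin k → Fin 2 × Fin 2) : ℕ :=
  ∑ n : Fin k, 4 ^ (n : ℕ) * ((u n).1 * p + (u n).2 * q)

lemma wordSum_lt {p q L : ℕ} (hL : p + q < 4 ^ L) {k : ℕ} (u : Fin k → Fin 2 × Fin 2) :
    wordSum p q u < 4 ^ (k + L) := by
  have h1 : wordSum p q u ≤ ∑ n : Fin k, 4 ^ (n : ℕ) * 4 ^ L := by
    refine sum_le_sum fun n _ => Nat.mul_le_mul_left _ ?_
    have h1 : ((u n).1 : ℕ) ≤ 1 := Fin.is_le _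
    have h2 : ((u n).2 : ℕ) ≤ 1 := Fin.is_le _
    nlinarith
  rw [← sum_mul, Fin.sum_univ_eq_sum_range (fun n => 4 ^ n)] at h1
  rw [pow_add]
  refine h1.trans_lt (Nat.mul_lt_mul_of_pos_right ?_ (by positivity))
  exact Nat.geomSum_lt (by norm_num) (by simp)

/-- Parseval's identity for the indicator function of an injective family in `ℤ / M`. -/
lemma sum_norm_sq_sum_stdAddChar {M : ℕ} [NeZero M] {ι : Type*} [Fintype ι] {s : ι → ZMod M}
    (hs : Function.Injective s) :
    ∑ r : ZMod M, ‖∑ i, ZMod.stdAddChar (r * s i)‖ ^ 2 = (M : ℝ) * Fintype.card ι := by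
  classical
  have key : ∑ r : ZMod M, ((‖∑ i, ZMod.stdAddChar (r * s i)‖ ^ 2 : ℝ) : ℂ)
      = (M : ℂ) * Fintype.card ι := by
    have : ∀ r : ZMod M, ((‖∑ i, ZMod.stdAddChar (r * s i)‖ ^ 2 : ℝ) : ℂ) =
        ∑ i, ∑ j, ZMod.stdAddChar (r * (s i - s j)) := by
      intro r
      rw [Complex.ofReal_pow, ← Complex.mul_conj', map_sum, sum_mul_sum]
      refine sum_congr rfl fun i _ => sum_congr rfl fun j _ => ?_
      rw [← AddChar.map_neg_eq_conj, ← AddChar.map_add_eq_mul]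
      congr 1; ring
    simp_rw [this]
    rw [sum_comm]
    simp_rw [sum_comm (s := (univ : Finset (ZMod M))),
      AddChar.sum_mulShift _ (ZMod.isPrimitive_stdAddChar M), sub_eq_zero, hs.eq_iff]
    simp [ZMod.card, mul_comm]
  exact_mod_cast key

lemma addChar_map_sum {A R ι : Type*} [AddCommMonoid A] [CommMonoid R] (ψ : AddChar A R)
    (s : Finset ι) (f : ι → A) : ψ (∑ i ∈ s, f i) = ∏ i ∈ s, ψ (f i) := by
  classical
  induction s using Finset.induction_on with
  | empty => simp
  | insert i s hi ih => rw [sum_insert hi, prod_insert hi, AddChar.map_add_eq_mul, ih]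

/-- The exponential sum over all words factors into a product. -/
lemma norm_sum_stdAddChar_wordSum {M : ℕ} [NeZero M] (p q k : ℕ) (r : ZMod M) :
    ‖∑ u : Fin k → Fin 2 × Fin 2, ZMod.stdAddChar (r * (wordSum p q u : ZMod M))‖ =
      (∏ n ∈ range k, ‖1 + ZMod.stdAddChar (r * (p : ZMod M)) ^ 4 ^ n‖) *
        ∏ n ∈ range k, ‖1 + ZMod.stdAddChar (r * (q : ZMod M)) ^ 4 ^ n‖ := by
  have h : ∀ u : Fin k → Fin 2 × Fin 2, ZMod.stdAddChar (r * (wordSum p q u : ZMod M)) =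
      ∏ n : Fin k, ((ZMod.stdAddChar (r * (p : ZMod M)) ^ 4 ^ (n : ℕ)) ^ ((u n).1 : ℕ) *
        (ZMod.stdAddChar (r * (q : ZMod M)) ^ 4 ^ (n : ℕ)) ^ ((u n).2 : ℕ)) := by
    intro u
    rw [wordSum, Nat.cast_sum, mul_sum, addChar_map_sum]
    refine prod_congr rfl fun n _ => ?_
    simp only [← AddChar.map_nsmul_eq_pow, ← AddChar.map_add_eq_mul]
    congr 1
    simp only [nsmul_eq_mul]
    push_cast
    ring
  simp_rw [h]
  rw [← Fintype.prod_sum fun (n : Fin k) (c : Fin 2 × Fin 2) =>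
    (ZMod.stdAddChar (r * (p : ZMod M)) ^ 4 ^ (n : ℕ)) ^ (c.1 : ℕ) *
      (ZMod.stdAddChar (r * (q : ZMod M)) ^ 4 ^ (n : ℕ)) ^ (c.2 : ℕ)]
  rw [← prod_mul_distrib, ← Fin.prod_univ_eq_prod_range
    (fun n => ‖1 + ZMod.stdAddChar (r * (p : ZMod M)) ^ 4 ^ n‖ *
      ‖1 + ZMod.stdAddChar (r * (q : ZMod M)) ^ 4 ^ n‖),
    norm_prod]
  refine prod_congr rfl fun n _ => ?_
  rw [← norm_mul]
  congr 1
  simp only [Fintype.sum_prod_type, Fin.sum_univ_two]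
  simp
  ring

/-- If the words of every length had distinct sums, Parseval's identity modulo `M = 4 ^ (k + L)`
would bound `k`: each frequency `M / 4 ^ j` with `1 ≤ j ≤ k` carries a fixed proportion of the
maximal mass. -/
lemma exists_not_injective_wordSum {p q : ℕ} (hp : Odd p) (hq : Odd q) (a b : ℕ) :
    ∃ k : ℕ, ¬ Function.Injective
      (wordSum (4 ^ a * p) (4 ^ b * q) : (Fin k → Fin 2 × Fin 2) → ℕ) := by
  by_contra! hinj
  set P := 4 ^ a * p with hP
  set Q := 4 ^ b * q with hQ
  obtain ⟨L, hL⟩ : ∃ L, P + Q < 4 ^ L := ⟨P + Q, Nat.lt_pow_self (by norm_num)⟩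
  have hp0 : 0 < p := hp.pos
  have hq0 : 0 < q := hq.pos
  set c : ℝ := 2 / (Real.pi * p) * (2 / (Real.pi * q)) with hc
  have hc0 : 0 < c := by positivity
  obtain ⟨k, hk⟩ := exists_nat_gt ((4 : ℝ) ^ L / c ^ 2)
  rw [div_lt_iff₀ (by positivity)] at hk
  refine hk.not_ge ?_
  set M := 4 ^ (k + L) with hM
  have hM0 : NeZero M := ⟨by positivity⟩
  have hs : Function.Injective
      (fun u : Fin k → Fin 2 × Fin 2 => (wordSum P Q u : ZMod M)) := by
    intro u v huv
    apply hinj k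
    have := (ZMod.natCast_eq_natCast_iff _ _ _).mp huv
    exact this.eq_of_lt_of_lt (wordSum_lt hL u) (wordSum_lt hL v)
  have hpars := sum_norm_sq_sum_stdAddChar hs
  set F : ZMod M → ℝ := fun r =>
    ‖∑ u : Fin k → Fin 2 × Fin 2, ZMod.stdAddChar (r * (wordSum P Q u : ZMod M))‖ with hF
  -- the frequency `e j` is `M / 4 ^ (j + 1)`
  let e : ℕ → ZMod M := fun j => ((4 ^ (k + L - (j + 1)) : ℕ) : ZMod M)
  have he : Set.InjOn e (range k) := by
    intro i hi j hj hij
    simp only [coe_range, Set.mem_Iio] at hi hj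
    have := (ZMod.natCast_eq_natCast_iff _ _ _).mp hij
    have := this.eq_of_lt_of_lt (Nat.pow_lt_pow_right (by norm_num) (by omega))
      (Nat.pow_lt_pow_right (by norm_num) (by omega))
    have := Nat.pow_right_injective (by norm_num : 2 ≤ 4) this
    omega
  have hchar : ∀ j < k, ∀ m : ℕ, (ZMod.stdAddChar (e j * (m : ZMod M)) : ℂ) =
      Complex.exp (Complex.I * ((2 * Real.pi * m / 4 ^ (j + 1) : ℝ) : ℂ)) := by
    intro j hj m
    have h1 : e j * (m : ZMod M) = ((4 ^ (k + L - (j + 1)) * m : ℤ) : ZMod M) := by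
      simp [e]
    rw [h1, ZMod.stdAddChar_coe]
    congr 1
    have h2 : (M : ℂ) = 4 ^ (k + L - (j + 1)) * 4 ^ (j + 1) := by
      rw [← pow_add, hM, Nat.sub_add_cancel (by omega)]; push_cast; rfl
    rw [h2]; push_cast; field_simp
  have hlow : ∀ j ∈ range k, (c * 4 ^ k) ^ 2 ≤ F (e j) ^ 2 := by
    intro j hj
    have hj := mem_range.mp hj
    have h1 := le_prod_of_four_pow_mul_odd hp a (j + 1) k (hchar j hj P)
    have h2 := le_prod_of_four_pow_mul_odd hq b (j + 1) k (hchar j hj Q)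
    have h3 : c ≤ _ := mul_le_mul h1 h2 (by positivity) (prod_nonneg fun n _ => by positivity)
    rw [prod_div_distrib, prod_div_distrib, prod_const, card_range, div_mul_div_comm,
      ← norm_sum_stdAddChar_wordSum, ← mul_pow, le_div_iff₀ (by positivity)] at h3
    norm_num only at h3
    gcongr
  have hfinal : (k : ℝ) * (c * 4 ^ k) ^ 2 ≤ M * 4 ^ k := by
    calc (k : ℝ) * (c * 4 ^ k) ^ 2 = ∑ j ∈ range k, (c * 4 ^ k) ^ 2 := by simp
      _ ≤ ∑ j ∈ range k, F (e j) ^ 2 := sum_le_sum hlow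
      _ = ∑ r ∈ (range k).image e, F r ^ 2 := (sum_image (f := fun r => F r ^ 2) he).symm
      _ ≤ ∑ r, F r ^ 2 := sum_le_sum_of_subset_of_nonneg (subset_univ _) fun _ _ _ => by positivity
      _ = M * 4 ^ k := by rw [hpars]; simp
  rw [hM] at hfinal
  push_cast at hfinal
  rw [pow_add, mul_pow] at hfinal
  refine le_of_mul_le_mul_right ?_ (by positivity : (0 : ℝ) < 4 ^ k * 4 ^ k)
  calc (k : ℝ) * c ^ 2 * (4 ^ k * 4 ^ k) = k * (c ^ 2 * (4 ^ k) ^ 2) := by ring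
    _ ≤ 4 ^ k * 4 ^ L * 4 ^ k := hfinal
    _ = _ := by ring

/-! ### Overlaps as relations between binary words -/

lemma four_pow_mul_blockMap {D : Set ℝ} {k : ℕ} (i : Fin k → D) (x : ℝ) :
    4 ^ k * blockMap i x = x + ∑ n, 4 ^ (n.rev : ℕ) * (i n : ℝ) := by
  induction k with
  | zero => simp [blockMap]
  | succ k ih =>
    have h := ih fun n => i n.succ
    rw [Fin.sum_univ_succ]
    simp only [blockMap, Function.comp_apply, contr, Fin.rev_succ, Fin.val_castSucc, Fin.rev_zero,
      Fin.val_last]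
    rw [pow_succ]
    linear_combination h

/-- The digit `3 (x + t y)` of `Φ_t`, which is the projection of the translation `(3x, 3y)` of the
four corner Cantor set; `x` and `y` are binary digits. -/
def digitOfPair (t : ℝ) (c : Fin 2 × Fin 2) : digits t :=
  ⟨3 * ((c.1 : ℕ) + t * (c.2 : ℕ)), by
    obtain ⟨x, y⟩ := c
    fin_cases x <;> fin_cases y <;> simp [digits, mul_add, add_comm]⟩

lemma digitOfPair_injective {t : ℝ} (ht0 : 0 < t) (ht1 : t < 1) :
    Function.Injective (digitOfPair t) := by
  rintro ⟨x, y⟩ ⟨x', y'⟩ h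
  have h := congrArg Subtype.val h
  simp only [digitOfPair] at h
  fin_cases x <;> fin_cases y <;> fin_cases x' <;> fin_cases y' <;>
    first | rfl | (exfalso; norm_num at h; try linarith)

lemma digitOfPair_surjective (t : ℝ) : Function.Surjective (digitOfPair t) := by
  rintro ⟨d, rfl | rfl | rfl | rfl⟩
  · exact ⟨(0, 0), by simp [digitOfPair]⟩
  · exact ⟨(0, 1), by simp [digitOfPair]⟩
  · exact ⟨(1, 0), by simp [digitOfPair]⟩
  · exact ⟨(1, 1), by simp [digitOfPair, mul_add, add_comm]⟩

lemma blockMap_eq_iff {t : ℝ} {k : ℕ} (u v : Fin k → Fin 2 × Fin 2) :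
    blockMap (fun n => digitOfPair t (u n)) = blockMap (fun n => digitOfPair t (v n)) ↔
      ∑ n : Fin k, (4 : ℝ) ^ (n.rev : ℕ) * (((u n).1 : ℕ) + t * ((u n).2 : ℕ)) =
        ∑ n : Fin k, (4 : ℝ) ^ (n.rev : ℕ) * (((v n).1 : ℕ) + t * ((v n).2 : ℕ)) := by
  have key : ∀ w : Fin k → Fin 2 × Fin 2, ∀ x,
      4 ^ k * blockMap (fun n => digitOfPair t (w n)) x = x +
        3 * ∑ n : Fin k, (4 : ℝ) ^ (n.rev : ℕ) * (((w n).1 : ℕ) + t * ((w n).2 : ℕ)) := by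
    intro w x
    rw [four_pow_mul_blockMap, mul_sum]
    simp only [digitOfPair]
    congr 1
    exact sum_congr rfl fun n _ => by ring
  constructor
  · intro h
    have hu := key u 0
    rw [h, key v 0] at hu
    linarith
  · intro h
    funext x
    have hu := key u x
    rw [h, ← key v x] at hu
    exact mul_left_cancel₀ (by positivity) hu

/-- The blocks are read backwards, since the last digit of a block carries the weight `4 ^ 0`. -/
lemma hasExactOverlap_iff {t : ℝ} (ht0 : 0 < t) (ht1 : t < 1) :
    HasExactOverlap t ↔ ∃ (k : ℕ) (u v : Fin k → Fin 2 × Fin 2), u ≠ v ∧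
      ∑ n : Fin k, (4 : ℝ) ^ (n : ℕ) * (((u n).1 : ℕ) + t * ((u n).2 : ℕ)) =
        ∑ n : Fin k, (4 : ℝ) ^ (n : ℕ) * (((v n).1 : ℕ) + t * ((v n).2 : ℕ)) := by
  have hrev : ∀ {k : ℕ} (w : Fin k → Fin 2 × Fin 2),
      ∑ n : Fin k, (4 : ℝ) ^ (n.rev : ℕ) * (((w n).1 : ℕ) + t * ((w n).2 : ℕ)) =
        ∑ n : Fin k, (4 : ℝ) ^ (n : ℕ) * (((w n.rev).1 : ℕ) + t * ((w n.rev).2 : ℕ)) := by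
    intro k w
    rw [← Equiv.sum_comp Fin.revPerm]
    simp
  constructor
  · rintro ⟨k, i, j, hij, h⟩
    choose u hu using fun n => digitOfPair_surjective t (i n)
    choose v hv using fun n => digitOfPair_surjective t (j n)
    obtain rfl : (fun n => digitOfPair t (u n)) = i := funext hu
    obtain rfl : (fun n => digitOfPair t (v n)) = j := funext hv
    refine ⟨k, fun n => u n.rev, fun n => v n.rev, fun huv => hij ?_, ?_⟩
    · funext n
      have := congrFun huv n.rev
      simp only [Fin.rev_rev] at this
      rw [this]
    · rw [← hrev, ← hrev]
      exact (blockMap_eq_iff u v).mp h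
  · rintro ⟨k, u, v, huv, h⟩
    refine ⟨k, fun n => digitOfPair t (u n.rev), fun n => digitOfPair t (v n.rev),
      fun hij => huv ?_, ?_⟩
    · funext n
      have := digitOfPair_injective ht0 ht1 (congrFun hij n.rev)
      simpa using this
    · rw [blockMap_eq_iff, hrev (fun n => u n.rev), hrev (fun n => v n.rev)]
      simpa only [Fin.rev_rev] using h

/-! ### Parity of the 2-adic valuation -/

lemma mem_Gam_iff {n : ℕ} : n ∈ Gam ↔ Odd (padicValNat 2 n) := by
  constructor
  · rintro ⟨k, l, hk, hl, rfl⟩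
    rw [padicValNat.mul (by omega) (by positivity), padicValNat.prime_pow,
      padicValNat.eq_zero_of_not_dvd (by omega)]
    exact ⟨l - 1, by omega⟩
  · intro h
    have hn : n ≠ 0 := by rintro rfl; simp at h
    obtain ⟨e, m, hm, rfl⟩ := Nat.exists_eq_two_pow_mul_odd hn
    rw [padicValNat.mul (by positivity) (by rintro rfl; simp at hm), padicValNat.prime_pow,
      padicValNat.eq_zero_of_not_dvd hm.not_two_dvd_nat] at h
    obtain ⟨l, hl⟩ := h
    obtain ⟨k, rfl⟩ := hm
    exact ⟨k + 1, l + 1, by omega, by omega, by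
      rw [mul_comm, show 2 * (l + 1) - 1 = e by omega, show 2 * (k + 1) - 1 = 2 * k + 1 by omega]⟩

lemma exists_eq_four_pow_mul_odd {n : ℕ} (hn : 0 < n) (h : n ∉ Gam) :
    ∃ a m, Odd m ∧ n = 4 ^ a * m := by
  obtain ⟨e, m, hm, rfl⟩ := Nat.exists_eq_two_pow_mul_odd hn.ne'
  rw [mem_Gam_iff, Nat.not_odd_iff_even, padicValNat.mul (by positivity) hm.pos.ne',
    padicValNat.prime_pow, padicValNat.eq_zero_of_not_dvd hm.not_two_dvd_nat] at h
  obtain ⟨a, ha⟩ := h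
  refine ⟨a, m, hm, ?_⟩
  rw [show e = 2 * a by omega, pow_mul]
  norm_num

/-- An integer with base `4` digits in `{-1, 0, 1}` has even 2-adic valuation, as its lowest nonzero
digit is odd; for the same reason it vanishes only if all its digits do. -/
lemma even_padicValInt_sum_four_pow {k : ℕ} (x : Fin k → ℤ) (hx : ∀ n, |x n| ≤ 1) :
    Even (padicValInt 2 (∑ n : Fin k, 4 ^ (n : ℕ) * x n)) ∧
      (∑ n : Fin k, 4 ^ (n : ℕ) * x n = 0 → x = 0) := by
  induction k with
  | zero => exact ⟨by simp, fun _ => Subsingleton.elim _ _⟩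
  | succ k ih =>
    obtain ⟨ih1, ih2⟩ := ih (fun n => x n.succ) fun n => hx _
    set S := ∑ n : Fin k, 4 ^ (n : ℕ) * x n.succ with hS
    have hsum : ∑ n : Fin (k + 1), 4 ^ (n : ℕ) * x n = x 0 + 4 * S := by
      rw [Fin.sum_univ_succ, hS, mul_sum]
      congr 1
      · simp
      · exact sum_congr rfl fun n _ => by rw [Fin.val_succ, pow_succ]; ring
    rw [hsum]
    have h0 := abs_le.mp (hx 0)
    by_cases hx0 : x 0 = 0
    · rw [hx0, zero_add]
      constructor
      · by_cases hS0 : S = 0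
        · simp [hS0]
        · rw [padicValInt.mul (by norm_num) hS0]
          have : padicValInt 2 4 = 2 := by
            rw [show (4 : ℤ) = ((2 ^ 2 : ℕ) : ℤ) by norm_num, padicValInt.of_nat,
              padicValNat.prime_pow]
          rw [this]
          exact even_two.add ih1
      · intro h
        have hS0 := ih2 (by omega)
        funext n
        refine Fin.cases hx0 (fun m => congrFun hS0 m) n
    · constructor
      · rw [padicValInt.eq_zero_of_not_dvd (by push_cast; omega)]
        simp
      · intro h; omega

/-- In lowest terms, a quotient of two numbers of even 2-adic valuation has numerator and denominator
of even 2-adic valuation, as one of the two is odd. -/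
lemma exists_coprime_notMem_Gam {X Y : ℕ} (hX : 0 < X) (hY : 0 < Y)
    (hXe : Even (padicValNat 2 X)) (hYe : Even (padicValNat 2 Y)) :
    ∃ p q : ℕ, 0 < p ∧ 0 < q ∧ Nat.Coprime p q ∧ (X : ℝ) / Y = (p : ℝ) / q ∧
      p ∉ Gam ∧ q ∉ Gam := by
  obtain ⟨g, p, q, hg, hpq, rfl, rfl⟩ := Nat.exists_coprime' (m := X) (n := Y)
    (Nat.gcd_pos_of_pos_left _ hX)
  have hp : 0 < p := Nat.pos_of_mul_pos_right hX
  have hq : 0 < q := Nat.pos_of_mul_pos_right hY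
  rw [padicValNat.mul hp.ne' hg.ne', Nat.even_add] at hXe
  rw [padicValNat.mul hq.ne' hg.ne', Nat.even_add] at hYe
  have hzero : padicValNat 2 p = 0 ∨ padicValNat 2 q = 0 := by
    by_cases h : 2 ∣ p
    · right
      refine padicValNat.eq_zero_of_not_dvd fun h' => ?_
      have := Nat.dvd_gcd h h'
      rw [hpq] at this
      omega
    · exact .inl (padicValNat.eq_zero_of_not_dvd h)
  have hiff := hXe.trans hYe.symm
  refine ⟨p, q, hp, hq, hpq, ?_, ?_⟩
  · push_cast
    field_simp
  rw [mem_Gam_iff, mem_Gam_iff, Nat.not_odd_iff_even, Nat.not_odd_iff_even]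
  rcases hzero with h | h
  · have hp2 : Even (padicValNat 2 p) := h ▸ Even.zero
    exact ⟨hp2, hiff.mp hp2⟩
  · have hq2 : Even (padicValNat 2 q) := h ▸ Even.zero
    exact ⟨hiff.mpr hq2, hq2⟩

end FourCorner

/-! ### The characterization of exact overlaps -/

open Finset in
theorem mainTheorem1 (t : ℝ) (ht0 : 0 < t) (ht1 : t < 1) :
    FourCorner.HasExactOverlap t ↔
      ∃ p q : ℕ, 0 < p ∧ 0 < q ∧ Nat.Coprime p q ∧ t = (p : ℝ) / (q : ℝ) ∧
        p ∉ FourCorner.Gam ∧ q ∉ FourCorner.Gam := by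
  rw [FourCorner.hasExactOverlap_iff ht0 ht1]
  constructor
  · rintro ⟨k, u, v, huv, h⟩
    -- `t` is the quotient of `|X|` and `|Y|`, where `X` and `Y` have base `4` digits in `{-1, 0, 1}`
    let x : Fin k → ℤ := fun n => ((u n).1 : ℕ) - ((v n).1 : ℕ)
    let y : Fin k → ℤ := fun n => ((u n).2 : ℕ) - ((v n).2 : ℕ)
    obtain ⟨hXe, hX0⟩ := FourCorner.even_padicValInt_sum_four_pow x fun n => by
      simp only [x, abs_le]; omega
    obtain ⟨hYe, hY0⟩ := FourCorner.even_padicValInt_sum_four_pow y fun n => by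
      simp only [y, abs_le]; omega
    set X := ∑ n : Fin k, 4 ^ (n : ℕ) * x n with hX
    set Y := ∑ n : Fin k, 4 ^ (n : ℕ) * y n with hY
    have hXY : (X : ℝ) + t * Y = 0 := by
      rw [← sub_eq_zero, ← sum_sub_distrib] at h
      rw [hX, hY, ← h]
      push_cast
      rw [mul_sum, ← sum_add_distrib]
      refine sum_congr rfl fun n _ => ?_
      simp only [x, y]
      push_cast
      ring
    have hYne : Y ≠ 0 := by
      intro hy
      have hx : X = 0 := by simpa [hy] using hXY
      refine huv (funext fun n => Prod.ext (Fin.ext ?_) (Fin.ext ?_))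
      · have := congrFun (hX0 hx) n
        simp only [x, Pi.zero_apply] at this
        omega
      · have := congrFun (hY0 hy) n
        simp only [y, Pi.zero_apply] at this
        omega
    have hXne : X ≠ 0 := by
      intro hx
      rw [hx, Int.cast_zero, zero_add] at hXY
      rcases mul_eq_zero.mp hXY with h | h
      · exact ht0.ne' h
      · exact hYne (by exact_mod_cast h)
    have ht : t = (X.natAbs : ℝ) / (Y.natAbs : ℝ) := by
      rw [Nat.cast_natAbs, Nat.cast_natAbs, Int.cast_abs, Int.cast_abs,
        eq_div_iff (abs_ne_zero.mpr (by exact_mod_cast hYne)), eq_neg_of_add_eq_zero_left hXY,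
        abs_neg, abs_mul, abs_of_pos ht0]
    rw [ht]
    exact FourCorner.exists_coprime_notMem_Gam (Int.natAbs_pos.mpr hXne) (Int.natAbs_pos.mpr hYne)
      hXe hYe
  · rintro ⟨p, q, hp, hq, -, ht, hpΓ, hqΓ⟩
    obtain ⟨a, p', hp', hpa⟩ := FourCorner.exists_eq_four_pow_mul_odd hp hpΓ
    obtain ⟨b, q', hq', hqb⟩ := FourCorner.exists_eq_four_pow_mul_odd hq hqΓ
    -- the digit `3 (x + t y)` is `3 / q` times the integer `x q + y p`
    obtain ⟨k, hk⟩ := FourCorner.exists_not_injective_wordSum hq' hp' b a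
    rw [← hpa, ← hqb] at hk
    simp only [Function.Injective, not_forall] at hk
    obtain ⟨u, v, h, huv⟩ := hk
    have hcast : ∀ w : Fin k → Fin 2 × Fin 2,
        ∑ n : Fin k, (4 : ℝ) ^ (n : ℕ) * (((w n).1 : ℕ) + t * ((w n).2 : ℕ)) =
          (FourCorner.wordSum q p w : ℝ) / q := by
      intro w
      rw [FourCorner.wordSum, ht, Nat.cast_sum, sum_div]
      refine sum_congr rfl fun n _ => ?_
      push_cast
      field_simp
    exact ⟨k, u, v, huv, by rw [hcast, hcast, h]⟩
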